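/- Let $k$ be an algebraically closed field of characteristic $0$ and let $n>1$ be an integer. Let $D$ be the extraspecial $2$-group of order $2^{2n+1}$ that is the central product of $n$ copies of the dihedral group of order $8$, and let $Q$ be the extraspecial $2$-group of order $2^{2n+1}$ that is the central product of the quaternion group of order $8$ and $n-1$ copies of the dihedral group of order $8$. Each $G\in\{D,Q\}$ is a central extension $$1\to \mathbb{F}_2\to G\to V_{2n}\to 1, \qquad V_{2n}=\mathbb{F}_2^{2n}.$$ Let $\kappa_G\in H^2(V_{2n},\mathbb{F}_2)$ be the class of such an extension, represented by the cocycle $\kappa_G$ with $s(u)s(v)=\kappa_G(u,v)\,s(u+v)$ for a set-theoretic section $s$ of $G\to V_{2n}$. Put $V_{2n+1}=\mathbb{F}_2\oplus V_{2n}$, with first coordinate $x_0$, and let $\omega_G\in H^3(V_{2n+1},k^\times)$ be the class of the $3$-cocycle $$\omega_G\big((a,u),(b,v),(c,w)\big)=(-1)^{a\,\kappa_G(v,w)},$$ i.e. the image of $x_0\cup\kappa_G$ under $H^3(V_{2n+1},\mathbb{F}_2)\to H^3(V_{2n+1},k^\times)$. Let $\mathrm{Stab}(\omega_G)\subset \mathrm{Aut}(V_{2n+1})$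 be the group of automorphisms $\alpha$ of $V_{2n+1}$ such that $\omega_G\circ(\alpha\times\alpha\times\alpha)$ and $\omega_G$ are cohomologous. Then, for every choice of the extension and of the section, $$\mathrm{Stab}(\omega_D)\cong Sp_{2n}(\mathbb{F}_2)\qquad\text{and}\qquad \mathrm{Stab}(\omega_Q)\cong Sp_{2n}(\mathbb{F}_2).$$ -/

import Mathlib

namespace ExtraspecialStab

section Cohomology

variable {G M : Type*} [Group G] [CommGroup M]

/-- The multiplicative `3`-cocycle condition for functions `G × G × G → M`, with `G` acting
trivially on the multiplicative abelian group `M`. -/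
def IsMulCocycle₃ (ω : G → G → G → M) : Prop :=
  ∀ g h x y : G, ω h x y * ω g (h * x) y * ω g h x = ω (g * h) x y * ω g h (x * y)

/-- The differential `(d μ)(g, h, x) = μ(h, x) μ(g, hx) / (μ(gh, x) μ(g, h))` of a `2`-cochain `μ`,
with `G` acting trivially on `M`. -/
def d₂ (μ : G → G → M) (g h x : G) : M :=
  μ h x * μ g (h * x) / (μ (g * h) x * μ g h)

/-- `ω` and `ω'` are cohomologous: `ω / ω'` is the differential of a `2`-cochain. -/
def IsCohomologous₃ (ω ω' : G → G → G → M) : Prop :=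
  ∃ μ : G → G → M, ∀ g h x : G, ω g h x / ω' g h x = d₂ μ g h x

/-- `Stab(ω)`: the group of all automorphisms `a` of `G` such that `ω ∘ (a × a × a)` and `ω` are
cohomologous. -/
def Stab (ω : G → G → G → M) : Subgroup (MulAut G) where
  carrier := {a | IsCohomologous₃ (fun g h x => ω (a g) (a h) (a x)) ω}
  one_mem' := ⟨fun _ _ => 1, fun g h x => by simp [d₂]⟩
  mul_mem' := by
    rintro a b ⟨μ, hμ⟩ ⟨ν, hν⟩
    refine ⟨fun g h => μ (b g) (b h) * ν g h, fun g h x => ?_⟩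
    have h₁ := hμ (b g) (b h) (b x)
    have h₂ := hν g h x
    simp only [MulAut.mul_apply, d₂, map_mul] at *
    rw [← div_mul_div_cancel _ (ω (b g) (b h) (b x)), h₁, h₂, div_mul_div_comm]
    congr 1 <;> ac_rfl
  inv_mem' := by
    rintro a ⟨μ, hμ⟩
    refine ⟨fun g h => (μ (a⁻¹ g) (a⁻¹ h))⁻¹, fun g h x => ?_⟩
    have h₁ := hμ (a⁻¹ g) (a⁻¹ h) (a⁻¹ x)
    simp only [d₂, map_mul, MulAut.apply_inv_self] at *
    rw [← inv_div, h₁]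
    simp only [← mul_inv, inv_div_inv, inv_div]

end Cohomology

section CentralProduct

variable {ι : Type*} [DecidableEq ι] (G : ι → Type*) [∀ i, Group (G i)] (z : ∀ i, G i)

/-- The normal subgroup of `∏ i, G i` generated by the elements `z i * (z j)⁻¹`, where `z i` is
placed in the `i`-th factor and `z j` in the `j`-th one. -/
def amalgam : Subgroup (∀ i, G i) :=
  Subgroup.normalClosure {g | ∃ i j, g = Pi.mulSingle i (z i) * (Pi.mulSingle j (z j))⁻¹}

instance : (amalgam G z).Normal := by unfold amalgam; infer_instance

/-- The central product of the groups `G i`, where `z i` generates the centre of `G i` (all of the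
same order): the quotient of `∏ i, G i` that identifies the elements `z i` with each other. -/
abbrev CentralProduct : Type _ := (∀ i, G i) ⧸ amalgam G z

end CentralProduct

/-- The dihedral group (`false`) and the quaternion group (`true`) of order `8`. -/
def Block : Bool → Type
  | false => DihedralGroup 4
  | true => QuaternionGroup 2

instance : ∀ b, Group (Block b)
  | false => inferInstanceAs (Group (DihedralGroup 4))
  | true => inferInstanceAs (Group (QuaternionGroup 2))

/-- The unique element of order `2` of the centre of `Block b`. -/
def Block.z : ∀ b, Block b
  | false => DihedralGroup.r 2
  | true => QuaternionGroup.a 2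

/-- The extraspecial group `D` of order `2 ^ (2 * n + 1)`: the central product of `n` copies of the
dihedral group of order `8`. -/
abbrev ExtraspecialD (n : ℕ) : Type :=
  CentralProduct (fun _ : Fin n => Block false) (fun _ => Block.z false)

/-- The extraspecial group `Q` of order `2 ^ (2 * n + 1)`, for `1 ≤ n`: the central product of the
quaternion group of order `8` and `n - 1` copies of the dihedral group of order `8`. -/
abbrev ExtraspecialQ (n : ℕ) : Type :=
  CentralProduct (fun i : Fin n => Block (decide (i.val = 0))) (fun _ => Block.z _)

/-- The field `𝔽₂`, viewed as a (multiplicatively written) group. -/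
abbrev F₂ : Type := Multiplicative (ZMod 2)

/-- The elementary abelian group of order `2 ^ m` (multiplicatively written). -/
abbrev ElemAb (m : ℕ) : Type := Multiplicative (Fin m → ZMod 2)

section Omega

variable {E W : Type*} [Group E] [Group W]

theorem exists_inl_eq (S : GroupExtension F₂ E W) (σ : S.Section) (u v : W) :
    ∃ a : F₂, S.inl a = σ u * σ v * (σ (u * v))⁻¹ := by
  have h : σ u * σ v * (σ (u * v))⁻¹ ∈ S.inl.range := by
    rw [S.range_inl_eq_ker_rightHom, MonoidHom.mem_ker]
    simp
  exact h

/-- The `2`-cocycle `κ` representing the class of the extension `1 → 𝔽₂ → E → W → 1`: it is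
determined by `σ u * σ v = κ(u, v) * σ (u * v)` for a set-theoretic section `σ`. -/
noncomputable def kappa (S : GroupExtension F₂ E W) (σ : S.Section) (u v : W) : F₂ :=
  (exists_inl_eq S σ u v).choose

theorem inl_kappa (S : GroupExtension F₂ E W) (σ : S.Section) (u v : W) :
    S.inl (kappa S σ u v) * σ (u * v) = σ u * σ v := by
  rw [kappa, (exists_inl_eq S σ u v).choose_spec, inv_mul_cancel_right]

/-- The `3`-cocycle `x₀ ∪ κ` on `𝔽₂ × W` with values in `kˣ`, where `x₀` is the first coordinate and
`𝔽₂` is identified with `{1, -1}`: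
`((a, u), (b, v), (c, w)) ↦ (-1) ^ (a * κ(v, w))`. -/
noncomputable def omega (k : Type*) [Field k] (S : GroupExtension F₂ E W) (σ : S.Section)
    (g h x : F₂ × W) : kˣ :=
  (-1) ^ (Multiplicative.toAdd g.1 * Multiplicative.toAdd (kappa S σ h.2 x.2)).val

theorem inl_comm (S : GroupExtension F₂ E W) (a : F₂) (e : E) :
    S.inl a * e = e * S.inl a := by
  have h := S.inl_conjAct_comm (e := e) (n := a)
  have key : ∀ x y : F₂, (x = 1 ↔ y = 1) → x = y := by decide
  rw [key (S.conjAct e a) a (by rw [map_eq_one_iff _ (S.conjAct e).injective])] at h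
  exact eq_mul_inv_iff_mul_eq.mp h

theorem kappa_cocycle (S : GroupExtension F₂ E W) (σ : S.Section) (u v w : W) :
    kappa S σ u v * kappa S σ (u * v) w = kappa S σ v w * kappa S σ u (v * w) := by
  apply S.inl_injective
  apply mul_right_cancel (b := σ (u * v * w))
  have h₁ : S.inl (kappa S σ u v * kappa S σ (u * v) w) * σ (u * v * w) = σ u * σ v * σ w := by
    rw [map_mul, mul_assoc, inl_kappa, ← mul_assoc, inl_kappa]
  have h₂ : S.inl (kappa S σ v w * kappa S σ u (v * w)) * σ (u * v * w) = σ u * σ v * σ w := by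
    rw [map_mul, mul_assoc, mul_assoc u v w, inl_kappa, ← mul_assoc, inl_comm, mul_assoc,
      inl_kappa, mul_assoc]
  rw [h₁, h₂]

/-- `omega` is a `3`-cocycle. -/
theorem isMulCocycle₃_omega (k : Type*) [Field k] (S : GroupExtension F₂ E W) (σ : S.Section) :
    IsMulCocycle₃ (omega k S σ) := by
  have hp : ∀ a b : ZMod 2, (-1 : kˣ) ^ (a + b).val = (-1) ^ a.val * (-1) ^ b.val := by
    intro a b
    rw [← pow_add, ZMod.val_add]
    exact (pow_eq_pow_mod _ (by simp)).symm
  intro g h x y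
  have := congrArg Multiplicative.toAdd (kappa_cocycle S σ h.2 x.2 y.2)
  simp only [toAdd_mul] at this
  simp only [omega, ← hp, Prod.fst_mul, Prod.snd_mul, toAdd_mul]
  congr 2
  linear_combination (Multiplicative.toAdd g.1) * this

end Omega

end ExtraspecialStab

open ExtraspecialStab

/-! Write q for the squaring map of the extension, a quadratic form on V = 𝔽₂²ⁿ with nondegenerate
polarization B. Evaluating a 3-cocycle at (g, g, g) and (g, 1, g) and multiplying kills coboundaries
when g² = 1; on ω this gives (-1)^(x₀(g) q(g)), so every α in the stabilizer preserves the function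
x₀q (`quad_of_mem_stab`). As n > 1, no nonzero linear form is constant on {q = 1}, which forces α to
preserve x₀. Hence α(a, v) = (a, Av + at) with q(Av + t) = q(v); polarizing, A is symplectic, and t
is determined by A.

Conversely, for A symplectic, q∘A + q is additive, hence equals B(·, s) for some s; put t = As. Then
v ↦ Av + t changes q by the constant q(As), which vanishes because the character sum of q is
nonzero. Up to a coboundary, κ∘α + κ is now l∪l + x₀∪l with l = B(·, s), because 2-cocycles on an
elementary abelian 2-group are detected by their squares. Its product with x₀ dies in kˣ: it is the
differential of i^(x₀ l), where i² = -1 (`mem_stab_of_quad`).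

The type of the form enters nowhere, so D and Q are treated together. -/

namespace ExtraspecialStab

/-! ### Cocycles detected by their squares -/

section Coboundary

/-- The underlying set of the extension of `G` by `𝔽₂` defined by a `2`-cocycle. -/
@[ext] structure TwistedProd (G : Type*) where
  fst : ZMod 2
  snd : G

theorem zmod_two_eq_zero_or_one (a : ZMod 2) : a = 0 ∨ a = 1 := by
  revert a; decide

/-- A `2`-cocycle with values in `𝔽₂` on a group of exponent `2` is a coboundary if all squares in
the corresponding extension are trivial. -/
theorem exists_coboundary {G : Type*} [Group G] (hG : ∀ g : G, g * g = 1) (c : G → G → ZMod 2)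
    (hc : ∀ g h x, c g h + c (g * h) x = c h x + c g (h * x))
    (hq : ∀ g, c g g + c 1 g = 0) :
    ∃ l : G → ZMod 2, ∀ g h, c g h = l g + l h + l (g * h) := by
  have two : ∀ a : ZMod 2, a + a = 0 := CharTwo.add_self_eq_zero
  have h1 : ∀ g, c 1 g = c 1 1 := fun g => by
    have := hc 1 1 g
    simp only [one_mul] at this
    linear_combination -this
  let _ : Add (TwistedProd G) := ⟨fun x y => ⟨x.1 + y.1 + c x.2 y.2, x.2 * y.2⟩⟩
  -- The cocycle need not be normalized, so the identity has first coordinate `c 1 1` (equal to its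
  -- negative in characteristic 2).
  let _ : Zero (TwistedProd G) := ⟨⟨c 1 1, 1⟩⟩
  let _ : Neg (TwistedProd G) := ⟨id⟩
  have add_def : ∀ x y : TwistedProd G, x + y = ⟨x.1 + y.1 + c x.2 y.2, x.2 * y.2⟩ :=
    fun _ _ => rfl
  have zero_def : (0 : TwistedProd G) = ⟨c 1 1, 1⟩ := rfl
  have self : ∀ x : TwistedProd G, x + x = 0 := fun x => by
    rw [add_def, zero_def, TwistedProd.mk.injEq]
    refine ⟨?_, hG _⟩
    linear_combination two x.1 + hq x.2 - h1 x.2 - two (c 1 1)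
  let _ : AddGroup (TwistedProd G) := AddGroup.ofLeftAxioms
    (fun x y z => by
      simp only [add_def, TwistedProd.mk.injEq, mul_assoc, and_true]
      linear_combination hc x.2 y.2 z.2)
    (fun x => by
      ext
      · simp only [add_def, zero_def]
        linear_combination h1 x.2 + two (c 1 1)
      · simp [add_def, zero_def])
    self
  have comm : ∀ x y : TwistedProd G, x + y = y + x := fun x y => by
    have h := self (x + y)
    exact (eq_neg_of_add_eq_zero_left h).trans (neg_add_rev x y)
  let _ : AddCommGroup (TwistedProd G) := { ‹AddGroup (TwistedProd G)› with add_comm := comm }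
  let _ : Module (ZMod 2) (TwistedProd G) := AddCommGroup.zmodModule fun x => by
    rw [two_nsmul, self]
  let _ : CommGroup G := { ‹Group G› with
    mul_comm := fun g h => by
      have := congrArg TwistedProd.snd (comm ⟨0, g⟩ ⟨0, h⟩)
      exact this }
  let _ : Module (ZMod 2) (Additive G) := AddCommGroup.zmodModule fun x => by
    rw [two_nsmul]; exact hG x
  let p : TwistedProd G →+ Additive G :=
    { toFun := fun x => Additive.ofMul x.2
      map_zero' := rfl
      map_add' := fun x y => rfl }
  -- An extension of exponent 2 is an 𝔽₂-vector space, so its projection splits; the first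
  -- coordinate of a splitting is the required cochain.
  obtain ⟨s, hs⟩ := (p.toZModLinearMap 2).exists_rightInverse_of_surjective
    (LinearMap.range_eq_top.2 fun g => ⟨⟨0, Additive.toMul g⟩, rfl⟩)
  have hs' : ∀ g : G, (s (Additive.ofMul g)).2 = g := fun g => LinearMap.congr_fun hs (Additive.ofMul g)
  refine ⟨fun g => (s (Additive.ofMul g)).1, fun g h => ?_⟩
  have := congrArg TwistedProd.fst (s.map_add (Additive.ofMul g) (Additive.ofMul h))
  rw [add_def] at this
  simp only [hs', ← ofMul_mul] at this
  linear_combination -this -two (s (Additive.ofMul g)).1 - two (s (Additive.ofMul h)).1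

end Coboundary

/-! ### The squaring map of an extension -/

section Square

variable {E W : Type*} [Group E] [Group W]

/-- The quadratic map of an extension by `𝔽₂`: the square of any lift of `v`. -/
noncomputable def quad (S : GroupExtension F₂ E W) (σ : S.Section) (v : W) : ZMod 2 :=
  Multiplicative.toAdd (kappa S σ v v) + Multiplicative.toAdd (kappa S σ 1 v)

theorem inl_mul_self (S : GroupExtension F₂ E W) (a : F₂) : S.inl a * S.inl a = 1 := by
  have h : ∀ a : F₂, a * a = 1 := by decide
  rw [← map_mul, h, map_one]

/-- The term κ(1, v) of `quad` accounts for σ(1), which need not be 1. Changing the lift by a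
central element of order at most 2 does not affect the square, so `quad` is independent of σ. -/
theorem inl_quad (S : GroupExtension F₂ E W) (σ : S.Section) (hW : ∀ v : W, v * v = 1) (x : E) :
    S.inl (Multiplicative.ofAdd (quad S σ (S.rightHom x))) = x * x := by
  have h₁ := inl_kappa S σ (S.rightHom x) (S.rightHom x)
  have h₂ := inl_kappa S σ 1 (S.rightHom x)
  rw [one_mul, mul_left_inj] at h₂
  rw [hW, ← h₂, ← map_mul] at h₁
  have h₃ : σ (S.rightHom x) * x⁻¹ ∈ S.inl.range := by
    rw [S.range_inl_eq_ker_rightHom, MonoidHom.mem_ker]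
    simp
  obtain ⟨a, ha⟩ := h₃
  rw [eq_mul_inv_iff_mul_eq] at ha
  rw [quad, ofAdd_add, ofAdd_toAdd, ofAdd_toAdd, h₁, ← ha, mul_assoc, ← mul_assoc x,
    ← inl_comm, mul_assoc, ← mul_assoc, inl_mul_self, one_mul]

end Square

/-! ### Signs and square roots of -1 -/

section Sign

variable (k : Type*) [Field k]

/-- The sign character `a ↦ (-1) ^ a` of `𝔽₂` with values in `kˣ`. -/
def sgn (a : ZMod 2) : kˣ := (-1) ^ a.val

theorem sgn_add (a b : ZMod 2) : sgn k (a + b) = sgn k a * sgn k b := by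
  rw [sgn, sgn, sgn, ← pow_add, ZMod.val_add]
  exact (pow_eq_pow_mod _ (by simp)).symm

@[simp] theorem sgn_zero : sgn k 0 = 1 := by simp [sgn]

theorem sgn_one : sgn k 1 = -1 := by simp [sgn, ZMod.val_one]

theorem sgn_inv (a : ZMod 2) : (sgn k a)⁻¹ = sgn k a := by
  rw [inv_eq_iff_mul_eq_one, ← sgn_add, CharTwo.add_self_eq_zero, sgn_zero]

theorem sgn_injective [CharZero k] : Function.Injective (sgn k) := by
  have h : (-1 : kˣ) ≠ 1 := by
    rw [Ne, Units.ext_iff]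
    simpa using (by norm_num : (-1 : k) ≠ 1)
  intro a b
  rcases zmod_two_eq_zero_or_one a with rfl | rfl <;>
    rcases zmod_two_eq_zero_or_one b with rfl | rfl <;> simp [sgn_one, h, h.symm]

variable {k}

/-- The integral lift of the cup product `x ∪ y` of two characters to `{0, 1}` exponentiates to a
`2`-cochain whose differential is `(-1) ^ (x ∪ y ∪ y + x ∪ x ∪ y)`. -/
theorem d₂_pow_val {G : Type*} [Group G] {i : kˣ} (hi : i ^ 2 = -1) (x y : G → ZMod 2)
    (hx : ∀ g h, x (g * h) = x g + x h) (hy : ∀ g h, y (g * h) = y g + y h) (g h t : G) :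
    d₂ (fun g h => i ^ ((x g).val * (y h).val)) g h t =
      sgn k (x g * y h * y t + x g * x h * y t) := by
  have h4 : i ^ 4 = 1 := by rw [show 4 = 2 * 2 from rfl, pow_mul, hi]; simp
  -- The lifts satisfy val(a + b) = val a + val b - 2 val a val b, so each carry contributes i² =
  -- -1: the one in c + d gives acd, the one in a + b gives abd.
  have key : ∀ a b c d : ZMod 2,
      i ^ (b.val * d.val) * i ^ (a.val * (c + d).val) / (i ^ ((a + b).val * d.val) *
        i ^ (a.val * c.val)) = sgn k (a * c * d + a * b * d) := by
    intro a b c d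
    rw [div_eq_iff_eq_mul, sgn, ← hi]
    rcases zmod_two_eq_zero_or_one a with rfl | rfl <;>
    rcases zmod_two_eq_zero_or_one b with rfl | rfl <;>
    rcases zmod_two_eq_zero_or_one c with rfl | rfl <;>
    rcases zmod_two_eq_zero_or_one d with rfl | rfl <;>
    simp [ZMod.val_one, show (1 + 1 : ZMod 2) = 0 from rfl,
      ← sq, ← pow_mul, h4]
  simp only [d₂, hx, hy]
  exact key _ _ _ _

end Sign

/-! ### Membership in the stabilizer through the quadratic map -/

section Stab

variable {E W : Type*} [Group E] [Group W] {k : Type*} [Field k]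

/-- For g² = 1 the values of a coboundary at (g, g, g) and (g, 1, g) are μ(g, 1)/μ(1, g) and its
inverse, so their product is an invariant of the class. -/
theorem quad_of_mem_stab [CharZero k] (S : GroupExtension F₂ E W) (σ : S.Section)
    (hW : ∀ v : W, v * v = 1) {α : MulAut (F₂ × W)} (hα : α ∈ Stab (omega k S σ)) (g : F₂ × W) :
    Multiplicative.toAdd (α g).1 * quad S σ (α g).2 = Multiplicative.toAdd g.1 * quad S σ g.2 := by
  obtain ⟨μ, hμ⟩ := hα
  have hg : g * g = 1 := Prod.ext ((by decide : ∀ a : F₂, a * a = 1) g.1) (hW g.2)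
  have h₁ := hμ g g g
  have h₂ := hμ g 1 g
  apply sgn_injective k
  have key : ∀ g : F₂ × W, sgn k (Multiplicative.toAdd g.1 * quad S σ g.2) =
      omega k S σ g g g * omega k S σ g 1 g := fun g => by
    rw [quad, mul_add, sgn_add]; rfl
  have h₃ : omega k S σ (α g) (α g) (α g) / omega k S σ g g g *
      (omega k S σ (α g) (α 1) (α g) / omega k S σ g 1 g) = 1 := by
    rw [h₁, h₂]
    simp only [d₂, hg, one_mul, mul_one]
    rw [div_mul_div_comm, div_eq_one]
    ac_rfl
  rw [map_one, div_mul_div_comm, div_eq_one] at h₃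
  rw [key, key, h₃]

/-- The correction to q in `hq` is the squaring map of l∪l + x₀∪l, a class whose cup product with x₀
becomes trivial in kˣ. -/
theorem mem_stab_of_quad [IsAlgClosed k] (S : GroupExtension F₂ E W) (σ : S.Section)
    (hW : ∀ v : W, v * v = 1) {α : MulAut (F₂ × W)} {l : W → ZMod 2}
    (hl : ∀ u v, l (u * v) = l u + l v) (hα : ∀ g, (α g).1 = g.1)
    (hq : ∀ g, quad S σ (α g).2 = quad S σ g.2 + l g.2 + Multiplicative.toAdd g.1 * l g.2) :
    α ∈ Stab (omega k S σ) := by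
  have hG : ∀ g : F₂ × W, g * g = 1 := fun g =>
    Prod.ext ((by decide : ∀ a : F₂, a * a = 1) g.1) (hW g.2)
  have hκ : ∀ u v w : W, _ := fun u v w => congrArg Multiplicative.toAdd (kappa_cocycle S σ u v w)
  simp only [toAdd_mul] at hκ
  have l1 : l 1 = 0 := by simpa using hl 1 1
  have sq : ∀ a : ZMod 2, a * a = a := by decide
  obtain ⟨m, hm⟩ := exists_coboundary hG
    (fun g h => Multiplicative.toAdd (kappa S σ (α g).2 (α h).2) +
      Multiplicative.toAdd (kappa S σ g.2 h.2) + l g.2 * l h.2 + Multiplicative.toAdd g.1 * l h.2)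
    (fun g h x => by
      simp only [map_mul, Prod.snd_mul, Prod.fst_mul, toAdd_mul, hl]
      linear_combination hκ (α g).2 (α h).2 (α x).2 + hκ g.2 h.2 x.2)
    (fun g => by
      have := hq g
      simp only [quad] at this
      simp only [map_one, Prod.snd_one, Prod.fst_one, toAdd_one, l1]
      linear_combination this + sq (l g.2) + CharTwo.add_self_eq_zero
        (l g.2 + Multiplicative.toAdd g.1 * l g.2 + Multiplicative.toAdd (kappa S σ g.2 g.2) +
          Multiplicative.toAdd (kappa S σ 1 g.2)))
  obtain ⟨i, hi⟩ := IsAlgClosed.exists_pow_nat_eq (-1 : k) (n := 2) (by norm_num)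
  have hi0 : i ≠ 0 := by rintro rfl; simp at hi
  have hi' : (Units.mk0 i hi0) ^ 2 = -1 := Units.ext (by simpa using hi)
  have hd := d₂_pow_val hi' (fun g : F₂ × W => Multiplicative.toAdd g.1) (fun g => l g.2)
    (fun _ _ => rfl) (fun _ _ => hl _ _)
  -- The first factor is x₀∪m, which takes care of the coboundary; the second cancels x₀∪l∪l +
  -- x₀∪x₀∪l.
  refine ⟨fun g h => sgn k (Multiplicative.toAdd g.1 * m h) *
    (Units.mk0 i hi0) ^ ((Multiplicative.toAdd g.1).val * (l h.2).val), fun g h x => ?_⟩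
  have hmul : ∀ (μ ν : F₂ × W → F₂ × W → kˣ), d₂ (fun g h => μ g h * ν g h) g h x =
      d₂ μ g h x * d₂ ν g h x := fun μ ν => by
    simp only [d₂, div_mul_div_comm]
    congr 1 <;> ac_rfl
  rw [hmul, hd, d₂]
  change sgn k (_ * _) / sgn k (_ * _) = _
  simp only [div_eq_mul_inv, sgn_inv, ← sgn_add, hα, Prod.fst_mul, toAdd_mul]
  congr 1
  linear_combination (Multiplicative.toAdd g.1) * (hm h x) - CharTwo.add_self_eq_zero
      (Multiplicative.toAdd g.1 * (l h.2 * l x.2 + Multiplicative.toAdd h.1 * l x.2)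
        + Multiplicative.toAdd h.1 * m x)
end Stab

/-! ### Quadratic forms over 𝔽₂ -/

section QuadraticForm

open Matrix

variable {n : ℕ}

/-- The quadratic form `∑ i, (x i * y i + ε i * (x i + y i))` in the coordinates `x i`, `y i`. -/
def quadForm (ε : Fin n → ZMod 2) (w : Fin n ⊕ Fin n → ZMod 2) : ZMod 2 :=
  ∑ i, (w (.inl i) * w (.inr i) + ε i * (w (.inl i) + w (.inr i)))

/-- The standard symplectic form over `𝔽₂`. -/
def symp (w w' : Fin n ⊕ Fin n → ZMod 2) : ZMod 2 := w ⬝ᵥ J (Fin n) (ZMod 2) *ᵥ w'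

theorem symp_eq_sum (w w' : Fin n ⊕ Fin n → ZMod 2) :
    symp w w' = ∑ i, (w (.inl i) * w' (.inr i) + w (.inr i) * w' (.inl i)) := by
  have h : J (Fin n) (ZMod 2) *ᵥ w' = Sum.elim (w' ∘ Sum.inr) (w' ∘ Sum.inl) := by
    have hneg : (-1 : Matrix (Fin n) (Fin n) (ZMod 2)) = 1 := by
      ext i j
      exact CharTwo.neg_eq _
    rw [J, fromBlocks_mulVec, hneg]
    simp
  rw [symp, h, dotProduct, Fintype.sum_sum_type, ← Finset.sum_add_distrib]
  rfl

theorem symp_add_left (u v w : Fin n ⊕ Fin n → ZMod 2) :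
    symp (u + v) w = symp u w + symp v w := add_dotProduct _ _ _

theorem quadForm_add (ε : Fin n → ZMod 2) (u v : Fin n ⊕ Fin n → ZMod 2) :
    quadForm ε (u + v) = quadForm ε u + quadForm ε v + symp u v := by
  simp only [quadForm, symp_eq_sum, ← Finset.sum_add_distrib, Pi.add_apply]
  exact Finset.sum_congr rfl fun i _ => by ring

@[simp] theorem quadForm_zero (ε : Fin n → ZMod 2) : quadForm ε 0 = 0 := by simp [quadForm]

theorem exists_eq_symp (l : (Fin n ⊕ Fin n → ZMod 2) →+ ZMod 2) : ∃ t, ∀ w, l w = symp w t := by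
  refine ⟨Sum.elim (fun i => l (Pi.single (.inr i) 1)) (fun i => l (Pi.single (.inl i) 1)),
    fun w => ?_⟩
  have h := (l.toZModLinearMap 2).pi_apply_eq_sum_univ w
  have hs : ∀ i : Fin n ⊕ Fin n, (fun j => if i = j then (1 : ZMod 2) else 0) = Pi.single i 1 :=
    fun i => by ext j; simp [Pi.single_apply, eq_comm]
  simp only [hs, AddMonoidHom.coe_toZModLinearMap] at h
  rw [h, symp_eq_sum, Fintype.sum_sum_type, ← Finset.sum_add_distrib]
  rfl

theorem eq_zero_of_symp (t : Fin n ⊕ Fin n → ZMod 2) (h : ∀ w, symp w t = 0) : t = 0 := by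
  ext (i | i)
  · have := h (Pi.single (.inr i) 1)
    simpa [symp_eq_sum, Pi.single_apply] using this
  · have := h (Pi.single (.inl i) 1)
    simpa [symp_eq_sum, Pi.single_apply] using this

/-- A linear form that is constant on the set where `quadForm ε` takes the value `1` is zero. -/
theorem eq_zero_of_quadForm_eq_one (hn : 1 < n) (ε : Fin n → ZMod 2)
    (l : (Fin n ⊕ Fin n → ZMod 2) →+ ZMod 2) (c : ZMod 2)
    (h : ∀ w, quadForm ε w = 1 → l w = c) : l = 0 := by
  have hQ : ∀ i, quadForm ε (Pi.single (.inl i) 1) = ε i ∧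
      quadForm ε (Pi.single (.inr i) 1) = ε i := fun i => by
    simp [quadForm, Pi.single_apply]
  -- If q(v) = 1 and B(v, e) = q(e), then q(v + e) = 1 too, so l(v + e) = l(v) and l(e) = 0.
  have key : ∀ e, l (Pi.single e 1) = 0 := fun e => by
    obtain ⟨i, hi⟩ : ∃ i, e = .inl i ∨ e = .inr i := by rcases e with i | i <;> exact ⟨i, by simp⟩
    obtain ⟨v, h₁, h₂⟩ : ∃ v, quadForm ε v = 1 ∧ symp v (Pi.single e 1) = ε i := by
      rcases zmod_two_eq_zero_or_one (ε i) with h0 | h1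
      · have : Nontrivial (Fin n) := Fin.nontrivial_iff_two_le.2 hn
        obtain ⟨j, hj⟩ := exists_ne i
        -- A second plane, orthogonal to `e`, is where n > 1 is needed; the sum of its basis vectors
        -- has q = 1 for either value of ε j.
        refine ⟨Pi.single (.inl j) 1 + Pi.single (.inr j) 1, ?_, ?_⟩
        · rw [quadForm_add, (hQ j).1, (hQ j).2, CharTwo.add_self_eq_zero]
          simp [symp_eq_sum, Pi.single_apply]
        · rw [symp_add_left, h0]
          rcases hi with rfl | rfl <;> simp [symp_eq_sum, Pi.single_apply, hj.symm]
      · rcases hi with rfl | rfl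
        · exact ⟨Pi.single (.inr i) 1, by rw [(hQ i).2, h1], by
            simp [symp_eq_sum, Pi.single_apply, h1]⟩
        · exact ⟨Pi.single (.inl i) 1, by rw [(hQ i).1, h1], by
            simp [symp_eq_sum, Pi.single_apply, h1]⟩
    have h₃ : quadForm ε (v + Pi.single e 1) = 1 := by
      have : quadForm ε (Pi.single e 1) = ε i := by
        rcases hi with rfl | rfl <;> simp [hQ]
      rw [quadForm_add, this, h₁, h₂, add_assoc, CharTwo.add_self_eq_zero, add_zero]
    have h₄ := h _ h₃
    rwa [map_add, h v h₁, add_eq_left] at h₄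
  ext w
  obtain ⟨t, ht⟩ := exists_eq_symp l
  have : t = 0 := by
    ext (i | i)
    · simpa [ht, symp_eq_sum, Pi.single_apply] using key (.inr i)
    · simpa [ht, symp_eq_sum, Pi.single_apply] using key (.inl i)
  simp [ht, this, symp]

/-- The character sum of `quadForm ε` does not vanish. -/
theorem sum_quadForm_ne_zero (ε : Fin n → ZMod 2) :
    ∑ w, ((sgn ℚ (quadForm ε w) : ℚˣ) : ℚ) ≠ 0 := by
  have hprod : ∀ (s : Finset (Fin n)) (f : Fin n → ZMod 2),
      sgn ℚ (∑ i ∈ s, f i) = ∏ i ∈ s, sgn ℚ (f i) := fun s f => by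
    induction s using Finset.cons_induction with
    | empty => simp
    | cons a s ha ih => rw [Finset.sum_cons, Finset.prod_cons, sgn_add, ih]
  let e : (Fin n ⊕ Fin n → ZMod 2) ≃ (Fin n → ZMod 2 × ZMod 2) :=
    (Equiv.sumArrowEquivProdArrow _ _ _).trans (Equiv.arrowProdEquivProdArrow _ _ _).symm
  have h : ∑ w, ((sgn ℚ (quadForm ε w) : ℚˣ) : ℚ) =
      ∑ p : Fin n → ZMod 2 × ZMod 2,
        ∏ i, ((sgn ℚ ((p i).1 * (p i).2 + ε i * ((p i).1 + (p i).2)) : ℚˣ) : ℚ) := by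
    refine Fintype.sum_equiv e _ _ fun w => ?_
    rw [quadForm, hprod, Units.coe_prod]
    rfl
  -- The sum factors over the n planes; each factor is 2 if ε i = 0 and -2 if ε i = 1.
  rw [h, ← Fintype.piFinset_univ, ← Finset.prod_univ_sum (f := fun i (p : ZMod 2 × ZMod 2) =>
    ((sgn ℚ (p.1 * p.2 + ε i * (p.1 + p.2)) : ℚˣ) : ℚ)), Finset.prod_ne_zero_iff]
  intro i _
  have hu : (Finset.univ : Finset (ZMod 2)) = {0, 1} := rfl
  rw [Fintype.sum_prod_type]
  simp only [hu, Finset.sum_pair (zero_ne_one (α := ZMod 2))]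
  rcases zmod_two_eq_zero_or_one (ε i) with h | h <;>
    simp [h, sgn_one, show (1 + 1 : ZMod 2) = 0 from rfl]

/-- If a bijection changes the values of `quadForm ε` by a constant, then that constant is zero. -/
theorem eq_zero_of_quadForm_equiv (ε : Fin n → ZMod 2)
    {A : (Fin n ⊕ Fin n → ZMod 2) → Fin n ⊕ Fin n → ZMod 2} (hA : Function.Bijective A)
    (c : ZMod 2) (h : ∀ w, quadForm ε (A w) = quadForm ε w + c) : c = 0 := by
  have h₁ := hA.sum_comp fun w => ((sgn ℚ (quadForm ε w) : ℚˣ) : ℚ)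
  simp only [h, sgn_add, Units.val_mul, ← Finset.sum_mul] at h₁
  have h₂ := mul_left_cancel₀ (sum_quadForm_ne_zero ε) (h₁.trans (mul_one _).symm)
  exact sgn_injective ℚ (by rw [sgn_zero]; exact Units.ext h₂)

end QuadraticForm

/-! ### The stabilizer as a symplectic group -/

section StabSymplectic

open Matrix

variable {n : ℕ}

theorem symp_mulVec (M : Matrix (Fin n ⊕ Fin n) (Fin n ⊕ Fin n) (ZMod 2))
    (u v : Fin n ⊕ Fin n → ZMod 2) :
    symp (M *ᵥ u) (M *ᵥ v) = u ⬝ᵥ (Mᵀ * J (Fin n) (ZMod 2) * M) *ᵥ v := by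
  rw [symp, ← mulVec_mulVec, ← mulVec_mulVec, dotProduct_mulVec u, vecMul_transpose]

theorem mem_symplecticGroup_iff_symp {M : Matrix (Fin n ⊕ Fin n) (Fin n ⊕ Fin n) (ZMod 2)} :
    M ∈ symplecticGroup (Fin n) (ZMod 2) ↔ ∀ u v, symp (M *ᵥ u) (M *ᵥ v) = symp u v := by
  rw [SymplecticGroup.mem_iff']
  refine ⟨fun h u v => by rw [symp_mulVec, h, symp], fun h => ?_⟩
  ext i j
  have h' := h (Pi.single i 1) (Pi.single j 1)
  rw [symp_mulVec, symp] at h'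
  simpa using h'

variable {V : Type*} [Group V] (θ : V ≃* Multiplicative (Fin n ⊕ Fin n → ZMod 2))

/-- The action of an automorphism of `𝔽₂ × V` on the second factor, in additive coordinates. -/
def linPart (α : MulAut (F₂ × V)) :
    (Fin n ⊕ Fin n → ZMod 2) →+ (Fin n ⊕ Fin n → ZMod 2) where
  toFun w := Multiplicative.toAdd (θ (α (1, θ.symm (Multiplicative.ofAdd w))).2)
  map_zero' := by
    rw [ofAdd_zero, map_one, Prod.mk_one_one, map_one, Prod.snd_one, map_one, toAdd_one]
  map_add' u v := by
    have h : ∀ v w : V, ((1 : F₂), v * w) = (1, v) * (1, w) := fun v w => by simp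
    rw [ofAdd_add, map_mul, h, map_mul, Prod.snd_mul, map_mul, toAdd_mul]

/-- The second coordinate of the image of `(1, 0)` under an automorphism of `𝔽₂ × V`. -/
def transPart (α : MulAut (F₂ × V)) : Fin n ⊕ Fin n → ZMod 2 :=
  Multiplicative.toAdd (θ (α (Multiplicative.ofAdd 1, 1)).2)

theorem toAdd_snd_apply (α : MulAut (F₂ × V)) (g : F₂ × V) :
    Multiplicative.toAdd (θ (α g).2) = linPart θ α (Multiplicative.toAdd (θ g.2)) +
      Multiplicative.toAdd g.1 • transPart θ α := by
  obtain ⟨a, v⟩ := g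
  have h : (a, v) = (1, v) * (a, 1) := by simp
  rw [h, map_mul, Prod.snd_mul, map_mul, toAdd_mul]
  congr 1
  · simp [linPart]
  · rcases zmod_two_eq_zero_or_one (Multiplicative.toAdd a) with ha | ha
    · obtain rfl : a = 1 := ha
      simp [Prod.mk_one_one]
    · obtain rfl : a = Multiplicative.ofAdd 1 := ha
      simp [transPart]

variable {θ} {k : Type*} [Field k] {E : Type*} [Group E] {S : GroupExtension F₂ E V}
  {σ : S.Section} {ε : Fin n → ZMod 2}

theorem mul_self_of_mulEquiv (θ : V ≃* Multiplicative (Fin n ⊕ Fin n → ZMod 2)) (v : V) :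
    v * v = 1 := by
  apply θ.injective
  rw [map_mul, map_one]
  apply Multiplicative.toAdd.injective
  ext i
  exact CharTwo.add_self_eq_zero _

theorem fst_apply_of_mem_stab [CharZero k] (hn : 1 < n)
    (hq : ∀ v, quad S σ v = quadForm ε (Multiplicative.toAdd (θ v)))
    {α : MulAut (F₂ × V)} (hα : α ∈ Stab (omega k S σ)) (g : F₂ × V) : (α g).1 = g.1 := by
  have h := quad_of_mem_stab S σ (mul_self_of_mulEquiv θ) hα
  let l : (Fin n ⊕ Fin n → ZMod 2) →+ ZMod 2 :=
    { toFun := fun w => Multiplicative.toAdd (α (1, θ.symm (Multiplicative.ofAdd w))).1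
      map_zero' := by
        rw [ofAdd_zero, map_one, Prod.mk_one_one, map_one, Prod.fst_one, toAdd_one]
      map_add' := fun u v => by
        have h : ∀ v w : V, ((1 : F₂), v * w) = (1, v) * (1, w) := fun v w => by simp
        rw [ofAdd_add, map_mul, h, map_mul, Prod.fst_mul, toAdd_mul] }
  set c := Multiplicative.toAdd (α (Multiplicative.ofAdd 1, 1)).1 with hc
  -- When q(w) = 1, invariance of x₀q at (1, w) forces the first coordinate l(w) + c of its image to
  -- be 1.
  have hl : l = 0 := by
    apply eq_zero_of_quadForm_eq_one hn ε l (1 + c)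
    intro w hw
    have h₁ := h (Multiplicative.ofAdd 1, θ.symm (Multiplicative.ofAdd w))
    rw [hq, hq] at h₁
    simp only [MulEquiv.apply_symm_apply, toAdd_ofAdd, hw, one_mul] at h₁
    have h₂ : (Multiplicative.ofAdd (1 : ZMod 2), θ.symm (Multiplicative.ofAdd w)) =
        (1, θ.symm (Multiplicative.ofAdd w)) * (Multiplicative.ofAdd 1, 1) := by simp
    have h₃ : ∀ a b : ZMod 2, a * b = 1 → a = 1 := by decide
    have h₄ := h₃ _ _ h₁
    rw [h₂, map_mul, Prod.fst_mul, toAdd_mul, ← hc] at h₄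
    exact (by decide : ∀ a b : ZMod 2, a + b = 1 → a = 1 + b) _ _ h₄
  have hfst : ∀ (a : F₂) (v : V), Multiplicative.toAdd (α (a, v)).1 = Multiplicative.toAdd a * c := by
    intro a v
    have h₁ : (a, v) = (1, v) * (a, 1) := by simp
    have h₂ : Multiplicative.toAdd (α (1, v)).1 = 0 := by
      have := DFunLike.congr_fun hl (Multiplicative.toAdd (θ v))
      simpa [l] using this
    rw [h₁, map_mul, Prod.fst_mul, toAdd_mul, h₂, zero_add]
    rcases zmod_two_eq_zero_or_one (Multiplicative.toAdd a) with ha | ha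
    · obtain rfl : a = 1 := ha
      simp [Prod.mk_one_one]
    · obtain rfl : a = Multiplicative.ofAdd 1 := ha
      simp [hc]
  -- Otherwise x₀∘α would vanish, against surjectivity.
  have hc1 : c = 1 := by
    obtain ⟨⟨a, v⟩, hg⟩ := α.surjective (Multiplicative.ofAdd 1, 1)
    have := hfst a v
    rw [hg] at this
    exact (by decide : ∀ a b : ZMod 2, 1 = a * b → b = 1) _ _ this
  have := hfst g.1 g.2
  rw [hc1, mul_one] at this
  exact this

/-- Invariance on the slice x₀ = 1 reads q(Aw + t) = q(w); at w = 0 it gives q(t) = 0, and expanding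
gives the formula. -/
theorem quadForm_linPart [CharZero k] (hn : 1 < n)
    (hq : ∀ v, quad S σ v = quadForm ε (Multiplicative.toAdd (θ v)))
    {α : MulAut (F₂ × V)} (hα : α ∈ Stab (omega k S σ)) (w : Fin n ⊕ Fin n → ZMod 2) :
    quadForm ε (linPart θ α w) = quadForm ε w + symp (linPart θ α w) (transPart θ α) := by
  have key : ∀ w, quadForm ε (linPart θ α w + transPart θ α) = quadForm ε w := fun w => by
    have h := quad_of_mem_stab S σ (mul_self_of_mulEquiv θ) hα
      (Multiplicative.ofAdd 1, θ.symm (Multiplicative.ofAdd w))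
    rw [fst_apply_of_mem_stab hn hq hα, hq, hq, toAdd_snd_apply] at h
    simpa using h
  have h₀ := key 0
  have h₁ := key w
  rw [map_zero, zero_add, quadForm_zero] at h₀
  rw [quadForm_add, h₀, add_zero] at h₁
  rw [← h₁, add_assoc, CharTwo.add_self_eq_zero, add_zero]

/-- The correction B(Aw, t) is additive in w, so it disappears on polarizing. -/
theorem symp_linPart [CharZero k] (hn : 1 < n)
    (hq : ∀ v, quad S σ v = quadForm ε (Multiplicative.toAdd (θ v)))
    {α : MulAut (F₂ × V)} (hα : α ∈ Stab (omega k S σ)) (u v : Fin n ⊕ Fin n → ZMod 2) :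
    symp (linPart θ α u) (linPart θ α v) = symp u v := by
  have h := quadForm_linPart hn hq hα (u + v)
  rw [map_add, quadForm_add, quadForm_add, symp_add_left, quadForm_linPart hn hq hα u,
    quadForm_linPart hn hq hα v] at h
  linear_combination h

/-- An additive bijection `A` and a vector `t` define an automorphism of `𝔽₂ × V`. -/
theorem exists_mulAut (θ : V ≃* Multiplicative (Fin n ⊕ Fin n → ZMod 2))
    {A : (Fin n ⊕ Fin n → ZMod 2) →+ (Fin n ⊕ Fin n → ZMod 2)} (hA : Function.Bijective A)
    (t : Fin n ⊕ Fin n → ZMod 2) : ∃ α : MulAut (F₂ × V), ∀ g, (α g).1 = g.1 ∧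
      Multiplicative.toAdd (θ (α g).2) = A (Multiplicative.toAdd (θ g.2)) +
        Multiplicative.toAdd g.1 • t := by
  let f : F₂ × V →* F₂ × V :=
    { toFun := fun g => (g.1, θ.symm (Multiplicative.ofAdd (A (Multiplicative.toAdd (θ g.2)) +
        Multiplicative.toAdd g.1 • t)))
      map_one' := by simp
      map_mul' := fun g h => by
        simp only [Prod.fst_mul, Prod.snd_mul, map_mul, toAdd_mul, map_add, add_smul,
          Prod.mk_mul_mk]
        rw [← map_mul, ← ofAdd_add, add_add_add_comm] }
  have hf : Function.Bijective f := by
    constructor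
    · rintro ⟨a, v⟩ ⟨b, w⟩ h
      have h₁ : a = b := congrArg Prod.fst h
      subst h₁
      have h₂ := congrArg (fun g => Multiplicative.toAdd (θ g.2)) h
      simp only [f, MonoidHom.coe_mk, OneHom.coe_mk, MulEquiv.apply_symm_apply, toAdd_ofAdd,
        add_left_inj] at h₂
      rw [θ.injective (Multiplicative.toAdd.injective (hA.1 h₂))]
    · rintro ⟨a, v⟩
      obtain ⟨w, hw⟩ := hA.2 (Multiplicative.toAdd (θ v) - Multiplicative.toAdd a • t)
      refine ⟨(a, θ.symm (Multiplicative.ofAdd w)), ?_⟩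
      simp [f, hw]
  exact ⟨MulEquiv.ofBijective f hf, fun g => ⟨rfl, by simp [f]⟩⟩

/-- If the quadratic map of the extension is `quadForm ε`, then `Stab` is the symplectic group. -/
theorem nonempty_stab_mulEquiv [CharZero k] [IsAlgClosed k] (hn : 1 < n)
    (hq : ∀ v, quad S σ v = quadForm ε (Multiplicative.toAdd (θ v))) :
    Nonempty (Stab (omega k S σ) ≃* symplecticGroup (Fin n) (ZMod 2)) := by
  have hmul : ∀ (A : (Fin n ⊕ Fin n → ZMod 2) →+ (Fin n ⊕ Fin n → ZMod 2)) w,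
      LinearMap.toMatrix' (A.toZModLinearMap 2) *ᵥ w = A w := fun A w =>
    LinearMap.toMatrix'_mulVec _ _
  let f : Stab (omega k S σ) →* symplecticGroup (Fin n) (ZMod 2) :=
    { toFun := fun α => ⟨LinearMap.toMatrix' ((linPart θ α.1).toZModLinearMap 2),
        mem_symplecticGroup_iff_symp.2 fun u v => by
          rw [hmul, hmul, symp_linPart hn hq α.2]⟩
      map_one' := Subtype.ext <| by
        have : (linPart θ (1 : MulAut (F₂ × V))).toZModLinearMap 2 = LinearMap.id := by
          refine LinearMap.ext fun w => ?_
          simp [linPart]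
        change LinearMap.toMatrix' ((linPart θ (1 : MulAut (F₂ × V))).toZModLinearMap 2) = 1
        rw [this, LinearMap.toMatrix'_id]
      map_mul' := fun α β => Subtype.ext <| by
        have : (linPart θ (α.1 * β.1)).toZModLinearMap 2 =
            (linPart θ α.1).toZModLinearMap 2 ∘ₗ (linPart θ β.1).toZModLinearMap 2 := by
          refine LinearMap.ext fun w => ?_
          have h := toAdd_snd_apply θ α.1 (β.1 (1, θ.symm (Multiplicative.ofAdd w)))
          -- Linear parts multiply because β maps the hyperplane x₀ = 0 to itself.
          rw [fst_apply_of_mem_stab hn hq β.2, toAdd_one, zero_smul, add_zero] at h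
          exact h
        change LinearMap.toMatrix' ((linPart θ (α.1 * β.1)).toZModLinearMap 2) =
          LinearMap.toMatrix' ((linPart θ α.1).toZModLinearMap 2) *
          LinearMap.toMatrix' ((linPart θ β.1).toZModLinearMap 2)
        rw [this, LinearMap.toMatrix'_comp] }
  refine ⟨MulEquiv.ofBijective f ⟨?_, ?_⟩⟩
  · rw [injective_iff_map_eq_one]
    rintro ⟨α, hα⟩ h
    have hA : ∀ w, linPart θ α w = w := fun w => by
      have h₁ : LinearMap.toMatrix' ((linPart θ α).toZModLinearMap 2) = 1 :=
        congrArg Subtype.val h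
      rw [← hmul, h₁, one_mulVec]
    -- With A = 1 the formula for q∘A leaves B(w, t) = 0 for all w.
    have ht : transPart θ α = 0 := eq_zero_of_symp _ fun w => by
      have := quadForm_linPart hn hq hα w
      rwa [hA, left_eq_add] at this
    apply Subtype.ext
    refine MulEquiv.ext fun g => Prod.ext (fst_apply_of_mem_stab hn hq hα g) ?_
    have := toAdd_snd_apply θ α g
    rw [hA, ht, smul_zero, add_zero] at this
    exact θ.injective (Multiplicative.toAdd.injective this)
  · rintro ⟨M, hM⟩
    have hdet : IsUnit M := by
      rw [isUnit_iff_isUnit_det]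
      exact SymplecticGroup.symplectic_det hM
    let A : (Fin n ⊕ Fin n → ZMod 2) →+ (Fin n ⊕ Fin n → ZMod 2) := M.mulVecLin.toAddMonoidHom
    have hAM : ∀ w, A w = M *ᵥ w := fun _ => rfl
    have hA : Function.Bijective A := ⟨mulVec_injective_iff_isUnit.2 hdet, mulVec_surjective_iff_isUnit.2 hdet⟩
    have hAs : ∀ u v, symp (A u) (A v) = symp u v := mem_symplecticGroup_iff_symp.1 hM
    obtain ⟨s, hs⟩ := exists_eq_symp
      { toFun := fun w => quadForm ε (A w) + quadForm ε w
        map_zero' := by simp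
        map_add' := fun u v => by
          rw [map_add, quadForm_add, quadForm_add, hAs]
          linear_combination CharTwo.add_self_eq_zero (symp u v) }
    simp only [AddMonoidHom.coe_mk, ZeroHom.coe_mk] at hs
    have hQ : ∀ w, quadForm ε (A w) = quadForm ε w + symp w s := fun w => by
      linear_combination hs w - CharTwo.add_self_eq_zero (quadForm ε w)
    -- Translating by As cancels the linear term B(w, s), so q changes only by the constant q(As).
    have h0 : quadForm ε (A s) = 0 := by
      refine eq_zero_of_quadForm_equiv ε (A := fun w => A w + A s)
        ((Equiv.addRight (A s)).bijective.comp hA) _ fun w => ?_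
      rw [quadForm_add, hAs, hQ w]
      linear_combination CharTwo.add_self_eq_zero (symp w s)
    obtain ⟨α, hα⟩ := exists_mulAut θ hA (A s)
    have hmem : α ∈ Stab (omega k S σ) := by
      refine mem_stab_of_quad S σ (mul_self_of_mulEquiv θ)
        (l := fun v => symp (Multiplicative.toAdd (θ v)) s)
        (fun u v => by rw [map_mul, toAdd_mul, symp_add_left]) (fun g => (hα g).1) fun g => ?_
      rw [hq, hq, (hα g).2]
      rcases zmod_two_eq_zero_or_one (Multiplicative.toAdd g.1) with ha | ha
      · rw [ha, zero_smul, add_zero, hQ, zero_mul, add_zero]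
      · rw [ha, one_smul, quadForm_add, h0, hAs, hQ, one_mul, add_zero]
    refine ⟨⟨α, hmem⟩, Subtype.ext ?_⟩
    have : linPart θ α = A := by
      refine AddMonoidHom.ext fun w => ?_
      have := (hα (1, θ.symm (Multiplicative.ofAdd w))).2
      simpa [linPart] using this
    change LinearMap.toMatrix' ((linPart θ α).toZModLinearMap 2) = M
    rw [this]
    exact LinearMap.toMatrix'_toLin' M

end StabSymplectic

/-! ### Independence of the chosen extension -/

section Recognition

variable {n : ℕ} {ε : Fin n → ZMod 2} {E : Type*} [Group E]

/-- The group `E` is a central extension of `𝔽₂ ^ (2 * n)`, the image of `c`, by `{1, ζ}` with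
quadratic map `quadForm ε`. -/
structure IsQuadExtension (ε : Fin n → ZMod 2) (ζ : E)
    (c : E →* Multiplicative (Fin n ⊕ Fin n → ZMod 2)) : Prop where
  ne_one : ζ ≠ 1
  mul_self : ζ * ζ = 1
  surjective : Function.Surjective c
  map_zeta : c ζ = 1
  eq_of_map_eq_one : ∀ x, c x = 1 → x = 1 ∨ x = ζ
  sq_eq : ∀ x, x * x = ζ ^ (quadForm ε (Multiplicative.toAdd (c x))).val

theorem pow_val_add {M : Type*} [Monoid M] {ζ : M} (h : ζ * ζ = 1) (a b : ZMod 2) :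
    ζ ^ (a + b).val = ζ ^ a.val * ζ ^ b.val := by
  rw [← pow_add, ZMod.val_add]
  exact (pow_eq_pow_mod _ ((sq ζ).trans h)).symm

theorem pow_val_injective {M : Type*} [Monoid M] {ζ : M} (h : ζ ≠ 1) :
    Function.Injective fun a : ZMod 2 => ζ ^ a.val := by
  intro a b hab
  rcases zmod_two_eq_zero_or_one a with rfl | rfl <;>
    rcases zmod_two_eq_zero_or_one b with rfl | rfl <;>
    simp_all [ZMod.val_one, eq_comm]

namespace IsQuadExtension

variable {ζ : E} {c : E →* Multiplicative (Fin n ⊕ Fin n → ZMod 2)}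

theorem nonempty_groupExtension (h : IsQuadExtension ε ζ c) {V : Type*} [Group V]
    (e : Multiplicative (Fin n ⊕ Fin n → ZMod 2) ≃* V) : Nonempty (GroupExtension F₂ E V) :=
  ⟨{ inl :=
      { toFun := fun a => ζ ^ (Multiplicative.toAdd a).val
        map_one' := by simp
        map_mul' := fun a b => by rw [toAdd_mul, pow_val_add h.mul_self] }
     rightHom := e.toMonoidHom.comp c
     inl_injective := fun a b hab => Multiplicative.toAdd.injective (pow_val_injective h.ne_one hab)
     range_inl_eq_ker_rightHom := by
      ext x
      rw [MonoidHom.mem_range, MonoidHom.mem_ker]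
      constructor
      · rintro ⟨a, rfl⟩
        simp [h.map_zeta]
      · intro hx
        have hx' : c x = 1 := e.injective (by rw [map_one]; exact hx)
        rcases h.eq_of_map_eq_one x hx' with rfl | rfl
        · exact ⟨1, by simp⟩
        · exact ⟨Multiplicative.ofAdd 1, by simp [ZMod.val_one]⟩
     rightHom_surjective := e.surjective.comp h.surjective }⟩

/-- If x and y commute then (xy)² = x²y², so B vanishes on their images; nondegeneracy concludes.
Thus any extension of this shape has the same kernel {1, ζ}. -/
theorem map_eq_one_of_central (h : IsQuadExtension ε ζ c) {x : E} (hx : ∀ y, x * y = y * x) :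
    c x = 1 := by
  apply Multiplicative.toAdd.injective
  apply eq_zero_of_symp
  intro w
  obtain ⟨y, hy⟩ := h.surjective (Multiplicative.ofAdd w)
  obtain rfl : w = Multiplicative.toAdd (c y) := by rw [hy]; rfl
  have h₁ : x * y * (x * y) = x * x * (y * y) := by
    rw [mul_assoc, ← mul_assoc y, ← hx y, mul_assoc, mul_assoc]
  rw [h.sq_eq, h.sq_eq, h.sq_eq, ← pow_val_add h.mul_self] at h₁
  have h₂ := pow_val_injective h.ne_one h₁
  rw [map_mul, mul_comm, toAdd_mul, quadForm_add] at h₂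
  linear_combination h₂

theorem inl_eq (h : IsQuadExtension ε ζ c) {V : Type*} [Group V] (S : GroupExtension F₂ E V) :
    S.inl (Multiplicative.ofAdd 1) = ζ := by
  refine (h.eq_of_map_eq_one _ (h.map_eq_one_of_central (inl_comm S _))).resolve_left fun h₁ => ?_
  rw [map_eq_one_iff _ S.inl_injective] at h₁
  exact absurd h₁ (by decide)

theorem inl_eq_pow (h : IsQuadExtension ε ζ c) {V : Type*} [Group V] (S : GroupExtension F₂ E V)
    (a : ZMod 2) : S.inl (Multiplicative.ofAdd a) = ζ ^ a.val := by
  rcases zmod_two_eq_zero_or_one a with rfl | rfl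
  · simp
  · simp [h.inl_eq, ZMod.val_one]

theorem ker_eq (h : IsQuadExtension ε ζ c) {V : Type*} [Group V] (S : GroupExtension F₂ E V) :
    S.rightHom.ker = c.ker := by
  ext x
  rw [← S.range_inl_eq_ker_rightHom, MonoidHom.mem_range, MonoidHom.mem_ker]
  constructor
  · rintro ⟨a, rfl⟩
    rw [← ofAdd_toAdd a, h.inl_eq_pow, map_pow, h.map_zeta, one_pow]
  · intro hx
    rcases h.eq_of_map_eq_one x hx with rfl | rfl
    · exact ⟨1, map_one _⟩
    · exact ⟨_, h.inl_eq S⟩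

theorem exists_mulEquiv (h : IsQuadExtension ε ζ c) {V : Type*} [Group V]
    (S : GroupExtension F₂ E V) :
    ∃ θ : V ≃* Multiplicative (Fin n ⊕ Fin n → ZMod 2), ∀ x, θ (S.rightHom x) = c x := by
  let θ := (QuotientGroup.quotientKerEquivOfSurjective S.rightHom S.rightHom_surjective).symm.trans
    ((QuotientGroup.quotientMulEquivOfEq (h.ker_eq S)).trans
      (QuotientGroup.quotientKerEquivOfSurjective c h.surjective))
  refine ⟨θ, fun x => ?_⟩
  have : S.rightHom x =
    QuotientGroup.quotientKerEquivOfSurjective S.rightHom S.rightHom_surjective x := rfl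
  rw [this]
  simp only [θ, MulEquiv.trans_apply, MulEquiv.symm_apply_apply]
  rfl

theorem nonempty_stab_mulEquiv (h : IsQuadExtension ε ζ c) (hn : 1 < n) (k : Type*) [Field k]
    [IsAlgClosed k] [CharZero k] {V : Type*} [Group V] (S : GroupExtension F₂ E V)
    (σ : S.Section) :
    Nonempty (Stab (omega k S σ) ≃* Matrix.symplecticGroup (Fin n) (ZMod 2)) := by
  obtain ⟨θ, hθ⟩ := h.exists_mulEquiv S
  refine ExtraspecialStab.nonempty_stab_mulEquiv (θ := θ) (ε := ε) hn fun v => ?_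
  obtain ⟨x, rfl⟩ := S.rightHom_surjective v
  have h₁ := inl_quad S σ (mul_self_of_mulEquiv θ) x
  rw [h.sq_eq, h.inl_eq_pow] at h₁
  rw [hθ]
  exact pow_val_injective h.ne_one h₁

end IsQuadExtension

end Recognition

/-! ### The two groups of order 8 -/

section Blocks

/-- The first coordinate of the image of an element of `Block b` modulo the centre. -/
def Block.x : ∀ b, Block b → ZMod 2
  -- The dihedral coordinates are dual to the involutions `sr 0` and `sr 1`, so that squaring
  -- becomes xy.
  | false, .r i => i.val
  | false, .sr i => i.val + 1
  | true, .a i => i.val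
  | true, .xa i => i.val

/-- The second coordinate of the image of an element of `Block b` modulo the centre. -/
def Block.y : ∀ b, Block b → ZMod 2
  | false, .r i => i.val
  | false, .sr i => i.val
  | true, .a _ => 0
  | true, .xa _ => 1

/-- The value `1` for the quaternion group and `0` for the dihedral group. -/
def Block.type : Bool → ZMod 2
  | false => 0
  | true => 1

namespace Block

instance : ∀ b, Fintype (Block b)
  | false => inferInstanceAs (Fintype (DihedralGroup 4))
  | true => inferInstanceAs (Fintype (QuaternionGroup 2))

instance : ∀ b, DecidableEq (Block b)
  | false => inferInstanceAs (DecidableEq (DihedralGroup 4))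
  | true => inferInstanceAs (DecidableEq (QuaternionGroup 2))

theorem x_mul : ∀ b (g h : Block b), x b (g * h) = x b g + x b h := by decide

theorem y_mul : ∀ b (g h : Block b), y b (g * h) = y b g + y b h := by decide

theorem z_mul_self : ∀ b, z b * z b = 1 := by decide

theorem z_ne_one : ∀ b, z b ≠ 1 := by decide

theorem z_comm : ∀ b (g : Block b), z b * g = g * z b := by decide

theorem exists_eq : ∀ b (s t : ZMod 2), ∃ g : Block b, x b g = s ∧ y b g = t := by decide

theorem exists_pow_eq : ∀ b (g : Block b), x b g = 0 → y b g = 0 →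
    ∃ a : ZMod 2, z b ^ a.val = g := by decide

theorem mul_self : ∀ b (g : Block b),
    g * g = z b ^ (x b g * y b g + type b * (x b g + y b g)).val := by decide

end Block

end Blocks

/-! ### Central products of blocks -/

section BlockProduct

variable {n : ℕ} (β : Fin n → Bool)

/-- The central product of the groups `Block (β i)`. -/
abbrev BlockProduct : Type := CentralProduct (fun i => Block (β i)) (fun i => Block.z (β i))

/-- The central element of `∏ i, Block (β i)` with prescribed coordinates. -/
def centralElt : Multiplicative (Fin n → ZMod 2) →* ∀ i, Block (β i) where
  toFun e i := Block.z (β i) ^ (Multiplicative.toAdd e i).val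
  map_one' := by ext i; simp
  map_mul' e f := by
    ext i
    exact pow_val_add (Block.z_mul_self _) _ _

theorem centralElt_injective : Function.Injective (centralElt β) := by
  intro e f h
  apply Multiplicative.toAdd.injective
  ext1 i
  exact pow_val_injective (Block.z_ne_one (β i)) (congrFun h i)

theorem centralElt_comm (e : Multiplicative (Fin n → ZMod 2)) (g : ∀ i, Block (β i)) :
    centralElt β e * g = g * centralElt β e := by
  ext i
  exact (Commute.pow_left (Block.z_comm (β i) (g i)) _)

theorem centralElt_single (i : Fin n) :
    centralElt β (Multiplicative.ofAdd (Pi.single i 1)) = Pi.mulSingle i (Block.z (β i)) := by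
  ext j
  by_cases h : j = i
  · subst h
    simp [centralElt, ZMod.val_one]
  · simp [centralElt, h]

/-- The central elements with coordinate sum 0 form a normal subgroup containing the generators. The
sum condition is what keeps ζ nontrivial in the quotient. -/
theorem exists_centralElt_of_mem_amalgam {g : ∀ i, Block (β i)}
    (hg : g ∈ amalgam (fun i => Block (β i)) (fun i => Block.z (β i))) :
    ∃ e, centralElt β e = g ∧ ∑ i, Multiplicative.toAdd e i = 0 := by
  let p : Multiplicative (Fin n → ZMod 2) →* F₂ :=
    { toFun := fun e => Multiplicative.ofAdd (∑ i, Multiplicative.toAdd e i)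
      map_one' := by simp
      map_mul' := fun e f => by
        rw [← ofAdd_add, ← Finset.sum_add_distrib]; rfl }
  let N := p.ker.map (centralElt β)
  have hN : N.Normal := ⟨by
    rintro _ ⟨e, he, rfl⟩ g
    rw [← centralElt_comm, mul_inv_cancel_right]
    exact ⟨e, he, rfl⟩⟩
  have hle : amalgam (fun i => Block (β i)) (fun i => Block.z (β i)) ≤ N := by
    apply Subgroup.normalClosure_le_normal
    rintro _ ⟨i, j, rfl⟩
    refine ⟨Multiplicative.ofAdd (Pi.single i 1) * (Multiplicative.ofAdd (Pi.single j 1))⁻¹, ?_, ?_⟩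
    · have hp : ∀ i, p (Multiplicative.ofAdd (Pi.single i 1)) = Multiplicative.ofAdd 1 := fun i =>
        congrArg Multiplicative.ofAdd
          (by simp : ∑ j, (Pi.single i 1 : Fin n → ZMod 2) j = 1)
      change p _ = 1
      rw [map_mul, map_inv, hp, hp, mul_inv_cancel]
    · rw [map_mul, map_inv, centralElt_single, centralElt_single]
  obtain ⟨e, he, rfl⟩ := hle hg
  exact ⟨e, rfl, he⟩

theorem mk_mulSingle_z (i j : Fin n) :
    ((Pi.mulSingle i (Block.z (β i)) : ∀ i, Block (β i)) : BlockProduct β) =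
      ((Pi.mulSingle j (Block.z (β j)) : ∀ i, Block (β i)) : BlockProduct β) := by
  rw [← mul_inv_eq_one, ← QuotientGroup.mk_inv, ← QuotientGroup.mk_mul, QuotientGroup.eq_one_iff]
  exact Subgroup.subset_normalClosure ⟨i, j, rfl⟩

theorem mk_centralElt (i : Fin n) (e : Fin n → ZMod 2) :
    (centralElt β (Multiplicative.ofAdd e) : BlockProduct β) =
      ((Pi.mulSingle i (Block.z (β i)) : ∀ i, Block (β i)) : BlockProduct β) ^ (∑ j, e j).val := by
  set ζ := ((Pi.mulSingle i (Block.z (β i)) : ∀ i, Block (β i)) : BlockProduct β) with hζ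
  have hζ2 : ζ * ζ = 1 := by
    rw [hζ, ← QuotientGroup.mk_mul, ← Pi.mulSingle_mul, Block.z_mul_self, Pi.mulSingle_one]
    rfl
  have hs : ∀ s : Finset (Fin n),
      (centralElt β (Multiplicative.ofAdd (∑ j ∈ s, Pi.single j (e j))) : BlockProduct β) =
        ζ ^ (∑ j ∈ s, e j).val := fun s => by
    induction s using Finset.cons_induction with
    | empty => simp
    | cons a s ha ih =>
      rw [Finset.sum_cons, Finset.sum_cons, pow_val_add hζ2, ofAdd_add, map_mul,
        QuotientGroup.mk_mul, ih]
      congr 1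
      rcases zmod_two_eq_zero_or_one (e a) with h | h
      · simp [h]
      · rw [h, centralElt_single, mk_mulSingle_z β a i, ZMod.val_one, pow_one]
  have := hs Finset.univ
  rwa [Finset.univ_sum_single] at this

/-- The coordinates of an element of `∏ i, Block (β i)` modulo the centre. -/
def blockCoord : (∀ i, Block (β i)) →* Multiplicative (Fin n ⊕ Fin n → ZMod 2) where
  toFun g := Multiplicative.ofAdd
    (Sum.elim (fun i => Block.x (β i) (g i)) (fun i => Block.y (β i) (g i)))
  map_one' := by
    rw [← ofAdd_zero]
    congr 1
    have h : ∀ b, Block.x b 1 = 0 ∧ Block.y b 1 = 0 := by decide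
    ext (i | i)
    · exact (h _).1
    · exact (h _).2
  map_mul' g h := by
    rw [← ofAdd_add]
    congr 1
    ext (i | i)
    · exact Block.x_mul _ _ _
    · exact Block.y_mul _ _ _

theorem blockCoord_centralElt (e : Multiplicative (Fin n → ZMod 2)) :
    blockCoord β (centralElt β e) = 1 := by
  have h : ∀ b (a : ZMod 2), Block.x b (Block.z b ^ a.val) = 0 ∧
    Block.y b (Block.z b ^ a.val) = 0 := by decide
  apply Multiplicative.toAdd.injective
  ext (i | i)
  · exact (h _ _).1
  · exact (h _ _).2

/-- The central product of dihedral and quaternion groups of order `8` is an extension of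
`𝔽₂ ^ (2 * n)` by `𝔽₂` whose quadratic map is `quadForm`. -/
theorem exists_isQuadExtension (i : Fin n) : ∃ (ζ : BlockProduct β)
    (c : BlockProduct β →* Multiplicative (Fin n ⊕ Fin n → ZMod 2)),
    IsQuadExtension (fun i => Block.type (β i)) ζ c := by
  let c : BlockProduct β →* Multiplicative (Fin n ⊕ Fin n → ZMod 2) :=
    QuotientGroup.lift _ (blockCoord β) fun g hg => by
      obtain ⟨e, rfl, -⟩ := exists_centralElt_of_mem_amalgam β hg
      exact blockCoord_centralElt β e
  have hc : ∀ g : ∀ i, Block (β i), c (g : BlockProduct β) = blockCoord β g := fun _ => rfl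
  refine ⟨((Pi.mulSingle i (Block.z (β i)) : ∀ i, Block (β i)) : BlockProduct β), c,
    ?_, ?_, ?_, ?_, ?_, ?_⟩
  · rw [Ne, QuotientGroup.eq_one_iff]
    intro h
    obtain ⟨e, he, hsum⟩ := exists_centralElt_of_mem_amalgam β h
    rw [← centralElt_single] at he
    rw [centralElt_injective β he] at hsum
    simp at hsum
  · rw [← QuotientGroup.mk_mul, ← Pi.mulSingle_mul, Block.z_mul_self, Pi.mulSingle_one]
    rfl
  · intro w
    choose g hg using fun j => Block.exists_eq (β j) (Multiplicative.toAdd w (.inl j))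
      (Multiplicative.toAdd w (.inr j))
    refine ⟨(g : BlockProduct β), ?_⟩
    rw [hc]
    apply Multiplicative.toAdd.injective
    ext (j | j)
    · exact (hg j).1
    · exact (hg j).2
  · rw [hc, ← centralElt_single, blockCoord_centralElt]
  · intro x hx
    obtain ⟨g, rfl⟩ := QuotientGroup.mk_surjective x
    rw [hc] at hx
    have hx' := congrArg Multiplicative.toAdd hx
    choose e he using fun j => Block.exists_pow_eq (β j) (g j) (congrFun hx' (.inl j))
      (congrFun hx' (.inr j))
    obtain rfl : centralElt β (Multiplicative.ofAdd e) = g := funext he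
    rw [mk_centralElt β i]
    rcases zmod_two_eq_zero_or_one (∑ j, e j) with h | h
    · left; rw [h]; simp
    · right; rw [h, ZMod.val_one, pow_one]
  · intro x
    obtain ⟨g, rfl⟩ := QuotientGroup.mk_surjective x
    rw [← QuotientGroup.mk_mul, hc]
    have : g * g = centralElt β (Multiplicative.ofAdd fun j => Block.x (β j) (g j) *
        Block.y (β j) (g j) + Block.type (β j) * (Block.x (β j) (g j) + Block.y (β j) (g j))) :=
      funext fun j => Block.mul_self (β j) (g j)
    rw [this, mk_centralElt β i]
    rfl

end BlockProduct

/-- The coordinates of `𝔽₂ ^ (2 * n)` split into two blocks of length `n`. -/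
def elemAbEquiv (n : ℕ) : Multiplicative (Fin n ⊕ Fin n → ZMod 2) ≃* ElemAb (2 * n) :=
  AddEquiv.toMultiplicative
    (LinearEquiv.funCongrLeft (ZMod 2) (ZMod 2)
      ((finCongr (two_mul n)).trans finSumFinEquiv.symm)).toAddEquiv

theorem nonempty_and_stab_mulEquiv_of_blockProduct (k : Type*) [Field k] [IsAlgClosed k]
    [CharZero k] {n : ℕ} (hn : 1 < n) (β : Fin n → Bool) :
    Nonempty (GroupExtension F₂ (BlockProduct β) (ElemAb (2 * n))) ∧
      ∀ (S : GroupExtension F₂ (BlockProduct β) (ElemAb (2 * n))) (σ : S.Section),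
        Nonempty (Stab (omega k S σ) ≃* Matrix.symplecticGroup (Fin n) (ZMod 2)) := by
  obtain ⟨ζ, c, h⟩ := exists_isQuadExtension β ⟨0, by omega⟩
  exact ⟨h.nonempty_groupExtension (elemAbEquiv n), h.nonempty_stab_mulEquiv hn k⟩

end ExtraspecialStab

theorem mainTheorem10 (k : Type*) [Field k] [IsAlgClosed k] [CharZero k] (n : ℕ) (hn : 1 < n) :
    (Nonempty (GroupExtension F₂ (ExtraspecialD n) (ElemAb (2 * n))) ∧
      ∀ (S : GroupExtension F₂ (ExtraspecialD n) (ElemAb (2 * n))) (σ : S.Section),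
        Nonempty (Stab (omega k S σ) ≃* Matrix.symplecticGroup (Fin n) (ZMod 2))) ∧
    (Nonempty (GroupExtension F₂ (ExtraspecialQ n) (ElemAb (2 * n))) ∧
      ∀ (S : GroupExtension F₂ (ExtraspecialQ n) (ElemAb (2 * n))) (σ : S.Section),
        Nonempty (Stab (omega k S σ) ≃* Matrix.symplecticGroup (Fin n) (ZMod 2))) :=
  ⟨nonempty_and_stab_mulEquiv_of_blockProduct k hn fun _ => false,
    nonempty_and_stab_mulEquiv_of_blockProduct k hn fun i => decide (i.val = 0)⟩
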